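/- Let $\mathcal K,\mathcal H$ be complex Hilbert spaces, let $\Pi:\mathcal K\to\mathcal H$ be a linear isometric embedding such that $(\Pi\mathcal K)^\perp$ is infinite dimensional, and let $T\in\mathbb B(\mathcal K)$ be a contraction, $\|T\|\le 1$, which is essentially unitary, that is, $T^*T-\mathbf 1$ and $TT^*-\mathbf 1$ are compact. Let $U_T\in\mathbb B(\mathcal H)$ be a unitary dilation of $T$, that is, $U_T$ is unitary and $T=\Pi^*U_T\Pi$, and set $F=2\,\Pi\Pi^*-\mathbf 1$. Definitions. For $A\in\mathbb B(\mathcal H)$ the essential spectrum $\sigma_{\rm ess}(A)$ is the set of $z\in\mathbb C$ for which $A-z\mathbf 1$ is not Fredholm, and $\mathrm{Ind}(T)=\dim\ker T-\dim\ker T^*$ for a Fredholm operator $T$. For a norm continuous path $s\in[0,1]\mapsto F_s$ of bounded self-adjoint Fredholm operators, call a partition $0=s_0<s_1<\dots<s_N=1$ together with numbers $-1<a_n<0<b_n<1$, $n=1,\dots,N$, admissible if for each $n$ the spectral projection $s\in[s_{n-1},s_n]\mapsto\chi_{(a_n,b_n]}(F_s)$ is norm continuous and of constant finite rank. The spectral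 flow is well defined if admissible data exist and $$\mathrm{SF}(s\in[0,1]\mapsto F_s)=\sum_{n=1}^N \mathrm{Tr}\bigl(\chi_{(a_n,0]}(F_{s_{n-1}})-\chi_{(a_n,0]}(F_{s_n})\bigr)$$ has the same value for all admissible data; this value is the spectral flow. Let $\Theta(F,U_T)$ be the set of all norm continuous paths $s\in[0,1]\mapsto F_s$ of bounded self-adjoint operators on $\mathcal H$ with $F_0=F$, $F_1=U_T^*FU_T$ and $F_s-F$ compact for all $s\in[0,1]$. Theorem. The operator $T$ is Fredholm; the commutator $[F,U_T]=FU_T-U_TF$ is compact; and, if $\mathcal K$ is infinite dimensional, $F$ is a self-adjoint Fredholm operator with $\|F\|=1$ and $\sigma_{\rm ess}(F)=\{-1,1\}$. The path $s\mapsto F+s\,U_T^*[F,U_T]$ belongs to $\Theta(F,U_T)$. Every path in $\Theta(F,U_T)$ consists of Fredholm operators and has a well-defined spectral flow, whose value, denoted by $\mathrm{SF}(F,U_T)$, is the same for all paths in $\Theta(F,U_T)$. Moreover $$\mathrm{Ind}(T)\;=\;-\,\mathrm{SF}(F,U_T)\;=\;-\,\mathrm{SF}\bigl(s\in[0,1]\mapsto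 F+s\,U_T^*[F,U_T]\bigr).$$ -/

import Mathlib

open scoped InnerProductSpace

namespace SpectralFlow

noncomputable section

open ContinuousLinearMap Module

section Operators

variable {H : Type*} [NormedAddCommGroup H] [InnerProductSpace ℂ H] [CompleteSpace H]

/-- The Noether index `dim Ker T - dim Ker T*` (meaningful for a Fredholm operator `T`). -/
def noetherIndex (T : H →L[ℂ] H) : ℤ :=
  (finrank ℂ T.ker : ℤ) - (finrank ℂ (adjoint T).ker : ℤ)

/-- `T` is essentially unitary: `T*T - 1` and `TT* - 1` are compact. -/
structure IsEssentiallyUnitary (T : H →L[ℂ] H) : Prop where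
  left : IsCompactOperator (adjoint T * T - 1 : H →L[ℂ] H)
  right : IsCompactOperator (T * adjoint T - 1 : H →L[ℂ] H)

/-- The essential spectrum: all `z` for which `A - z` is not Fredholm. -/
def essentialSpectrum (A : H →L[ℂ] H) : Set ℂ :=
  {z | ¬ (A - z • (1 : H →L[ℂ] H)).IsFredholm}

variable (H) in
/-- The self-adjoint Fredholm operators. -/
def selfAdjointFredholm : Set (H →L[ℂ] H) :=
  {A | IsSelfAdjoint A ∧ A.IsFredholm}

variable (H) in
/-- The self-adjoint Fredholm operators with both positive and negative essential spectrum. -/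
def selfAdjointFredholmStar : Set (H →L[ℂ] H) :=
  {A | A ∈ selfAdjointFredholm H ∧
    (∃ x : ℝ, 0 < x ∧ (x : ℂ) ∈ essentialSpectrum A) ∧
    (∃ x : ℝ, x < 0 ∧ (x : ℂ) ∈ essentialSpectrum A)}

variable (H) in
/-- The operators in `selfAdjointFredholmStar` of norm one with essential spectrum `{-1, 1}`. -/
def selfAdjointFredholmHat : Set (H →L[ℂ] H) :=
  {A | A ∈ selfAdjointFredholmStar H ∧ ‖A‖ = 1 ∧ essentialSpectrum A = {-1, 1}}

/-- The spectral projection `χ_{(-∞, c]}(A)` of a bounded self-adjoint operator `A`: the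
orthogonal projection onto the kernel of the positive part `(A - c)₊`. -/
def spectralFamily (A : H →L[ℂ] H) (c : ℝ) : H →L[ℂ] H :=
  haveI : CompleteSpace (cfc (fun x : ℝ => max (x - c) 0) A).ker :=
    (ContinuousLinearMap.isClosed_ker _).completeSpace_coe
  (cfc (fun x : ℝ => max (x - c) 0) A).ker.starProjection

/-- The spectral projection `χ_{(a, b]}(A)` of a bounded self-adjoint operator `A`,
for `a ≤ b`. -/
def spectralProj (A : H →L[ℂ] H) (a b : ℝ) : H →L[ℂ] H :=
  spectralFamily A b - spectralFamily A a

/-- Data admissible for computing the spectral flow of the path `γ` on `[0, 1]`: a partition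
`0 = s₀ < s₁ < … < s_N = 1` and numbers `-1 < aₙ < 0 < bₙ < 1` such that on each
`[sₙ₋₁, sₙ]` the projection `χ_{(aₙ, bₙ]}(γ t)` is norm continuous in `t` and of constant
finite rank. -/
structure IsAdmissible (γ : ℝ → H →L[ℂ] H) {N : ℕ} (s : Fin (N + 1) → ℝ) (a b : Fin N → ℝ) :
    Prop where
  strictMono : StrictMono s
  first : s 0 = 0
  last : s (Fin.last N) = 1
  mem_a : ∀ n, a n ∈ Set.Ioo (-1 : ℝ) 0
  mem_b : ∀ n, b n ∈ Set.Ioo (0 : ℝ) 1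
  continuousOn : ∀ n, ContinuousOn (fun t => spectralProj (γ t) (a n) (b n))
    (Set.Icc (s n.castSucc) (s n.succ))
  rank : ∀ n, ∃ r : ℕ, ∀ t ∈ Set.Icc (s n.castSucc) (s n.succ),
    FiniteDimensional ℂ (spectralProj (γ t) (a n) (b n)).range ∧
      finrank ℂ (spectralProj (γ t) (a n) (b n)).range = r

/-- The number `∑ₙ Tr (χ_{(aₙ, 0]}(γ sₙ₋₁) - χ_{(aₙ, 0]}(γ sₙ))`. For admissible data these are
finite-dimensional orthogonal projections, whose traces are the dimensions of their ranges. -/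
def partitionFlow (γ : ℝ → H →L[ℂ] H) {N : ℕ} (s : Fin (N + 1) → ℝ) (a : Fin N → ℝ) : ℤ :=
  ∑ n : Fin N, ((finrank ℂ (spectralProj (γ (s n.castSucc)) (a n) 0).range : ℤ) -
    (finrank ℂ (spectralProj (γ (s n.succ)) (a n) 0).range : ℤ))

/-- The spectral flow of the path `γ` on `[0, 1]` is well defined and equal to `m`: `γ` is a
norm continuous path of self-adjoint Fredholm operators, admissible data exist, and all
admissible data give the value `m`. -/
structure HasSpectralFlow (γ : ℝ → H →L[ℂ] H) (m : ℤ) : Prop where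
  continuousOn : ContinuousOn γ (Set.Icc 0 1)
  mem : ∀ t ∈ Set.Icc (0 : ℝ) 1, γ t ∈ selfAdjointFredholm H
  exists_admissible : ∃ (N : ℕ) (s : Fin (N + 1) → ℝ) (a b : Fin N → ℝ), IsAdmissible γ s a b
  value : ∀ (N : ℕ) (s : Fin (N + 1) → ℝ) (a b : Fin N → ℝ), IsAdmissible γ s a b →
    partitionFlow γ s a = m

open Classical in
/-- The spectral flow of a path on `[0, 1]` (with value `0` where it is not well defined). -/
def spectralFlow (γ : ℝ → H →L[ℂ] H) : ℤ :=
  if h : ∃ m, HasSpectralFlow γ m then h.choose else 0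

/-- The class `Θ(F, U)` of norm continuous paths of self-adjoint operators from `F` to `U* F U`
through compact perturbations of `F`. -/
structure IsPerturbationPath (F U : H →L[ℂ] H) (γ : ℝ → H →L[ℂ] H) : Prop where
  continuousOn : ContinuousOn γ (Set.Icc 0 1)
  isSelfAdjoint : ∀ t ∈ Set.Icc (0 : ℝ) 1, IsSelfAdjoint (γ t)
  zero : γ 0 = F
  isCompact : ∀ t ∈ Set.Icc (0 : ℝ) 1, IsCompactOperator (γ t - F : H →L[ℂ] H)
  one : γ 1 = adjoint U * F * U

/-- `SF(F, U)` is well defined and equal to `m`: the class `Θ(F, U)` is not empty, and each of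
its paths has the well-defined spectral flow `m`. -/
structure HasPairSpectralFlow (F U : H →L[ℂ] H) (m : ℤ) : Prop where
  nonempty : ∃ γ, IsPerturbationPath F U γ
  value : ∀ γ, IsPerturbationPath F U γ → HasSpectralFlow γ m

open Classical in
/-- The common value `SF(F, U)` of the spectral flow on `Θ(F, U)` (with value `0` where it is
not well defined). -/
def pairSpectralFlow (F U : H →L[ℂ] H) : ℤ :=
  if h : ∃ m, HasPairSpectralFlow F U m then h.choose else 0

/-- The path `s ↦ F + s U* [F, U]`. -/
def linePath (F U : H →L[ℂ] H) (s : ℝ) : H →L[ℂ] H :=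
  F + (s : ℂ) • (adjoint U * (F * U - U * F))

end Operators

section Dilations

variable {K H : Type*} [NormedAddCommGroup K] [InnerProductSpace ℂ K] [CompleteSpace K]
  [NormedAddCommGroup H] [InnerProductSpace ℂ H] [CompleteSpace H]

/-- `U` is a unitary dilation of `T` along the isometric embedding `J`: `T = J* U J`. -/
structure IsUnitaryDilation (J : K →ₗᵢ[ℂ] H) (T : K →L[ℂ] K) (U : H →L[ℂ] H) : Prop where
  unitary : U ∈ unitary (H →L[ℂ] H)
  compression : T = adjoint J.toContinuousLinearMap ∘L U ∘L J.toContinuousLinearMap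

/-- The symmetry `F = 2 J J* - 1`. -/
def dilationSymmetry (J : K →ₗᵢ[ℂ] H) : H →L[ℂ] H :=
  (2 : ℂ) • (J.toContinuousLinearMap ∘L adjoint J.toContinuousLinearMap) - 1

end Dilations

end

end SpectralFlow

open scoped InnerProductSpace
namespace SpectralFlow
noncomputable section
open ContinuousLinearMap Module

/-! Write `P` for the projection onto the range of the isometry, so that `F = 2P - 1`, and `E_c(A)`
for `χ_{(-∞, c]}(A)`. Along a path in `Θ(F, U)` every operator is a compact perturbation of `F`,
hence every `E_c` with `|c| < 1` is a compact perturbation of `1 - P`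
(`isCompactOperator_spectralFamily_sub`). Two such projections have a relative dimension `relIndex`.
It is the index of the compression of one range to the other, so it is additive
(`relIndex_triangle`), and it vanishes along norm continuous families
(`relIndex_eq_zero_of_continuousOn`).

Each summand of the spectral flow is a relative dimension of the spaces at level `0`, because the
level `aₙ` contributes nothing. The sum telescopes to a number depending only on the end points
(`partitionFlow_eq_relIndex`), which settles independence of the partition and of the path. For the
symmetries `F` and `U*FU` the two intersections defining this number are isometric copies of `ker T`
and `ker T*` (`IsUnitaryDilation.relIndex_eq`). -/

open scoped LinearMap.FiniteRangeSetoid in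
-- The two maps coincide on a subspace of finite codimension. Composing with its inclusion gives one
-- and the same map, and additivity lets the index of the inclusion cancel.
theorem index_eq_of_equiv {V W : Type*} [AddCommGroup V] [Module ℂ V] [AddCommGroup W]
    [Module ℂ W] {f g : V →ₗ[ℂ] W} (h : f ≈ g)
    [FiniteDimensional ℂ f.ker] [FiniteDimensional ℂ (W ⧸ f.range)]
    [FiniteDimensional ℂ g.ker] [FiniteDimensional ℂ (W ⧸ g.range)] :
    f.index = g.index := by
  have hc : (LinearMap.eqLocus f g).CoFG := LinearMap.FiniteRangeSetoid.equiv_iff_eqLocus_coFG.mp h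
  set i := (LinearMap.eqLocus f g).subtype with hi
  have : FiniteDimensional ℂ i.ker := by rw [hi, Submodule.ker_subtype]; infer_instance
  have : FiniteDimensional ℂ (V ⧸ i.range) := by rw [hi, Submodule.range_subtype]; exact hc
  have hfg : f ∘ₗ i = g ∘ₗ i := by
    ext x
    exact x.2
  have h1 := LinearMap.index_comp (f := i) f
  have h2 := LinearMap.index_comp (f := i) g
  rw [hfg] at h1
  linarith

/-! ### Compact perturbations, Fredholm operators and the index -/

section Fredholm

variable {E G : Type*} [NormedAddCommGroup E] [InnerProductSpace ℂ E]
  [NormedAddCommGroup G] [InnerProductSpace ℂ G]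

omit [InnerProductSpace ℂ E] [InnerProductSpace ℂ G] in
theorem isCompactOperator_of_forall_eq {f g : E → G} (hf : IsCompactOperator f)
    (h : ∀ x, g x = f x) : IsCompactOperator g :=
  (funext h : g = f) ▸ hf

/-- A compact operator into a Hilbert space is a norm limit of finite rank operators. -/
theorem exists_finiteRange_norm_sub_le [CompleteSpace G] {K : E →L[ℂ] G}
    (hK : IsCompactOperator K) {ε : ℝ} (hε : 0 < ε) :
    ∃ L : E →L[ℂ] G, FiniteDimensional ℂ L.range ∧ ‖K - L‖ ≤ ε := by
  have hc := (hK.isCompact_closure_image_closedBall 1).totallyBounded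
  obtain ⟨t, ht, hcov⟩ := Metric.totallyBounded_iff.mp hc ε hε
  -- The approximant is `K` projected onto the span of a finite `ε`-net of the image of the unit
  -- ball.
  let S := Submodule.span ℂ t
  have : FiniteDimensional ℂ S := FiniteDimensional.span_of_finite ℂ ht
  refine ⟨S.starProjection ∘L K, ?_, ?_⟩
  · have hle : (S.starProjection ∘L K).range ≤ S := by
      rintro _ ⟨x, rfl⟩
      exact S.starProjection_apply_mem _
    exact Submodule.finiteDimensional_of_le hle
  · refine ContinuousLinearMap.opNorm_le_of_unit_norm (𝕜 := ℂ) hε.le fun x hx => ?_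
    have hx' : K x ∈ closure (K '' Metric.closedBall 0 1) :=
      subset_closure ⟨x, by simp [hx], rfl⟩
    obtain ⟨y, hy, hxy⟩ := Set.mem_iUnion₂.mp (hcov hx')
    have hyS : y ∈ S := Submodule.subset_span hy
    have h1 : ‖K x - S.starProjection (K x)‖ ≤ ‖K x - y‖ := by
      rw [Submodule.starProjection_minimal]
      exact ciInf_le ⟨0, by rintro _ ⟨z, rfl⟩; positivity⟩ (⟨y, hyS⟩ : S)
    have h2 : ‖K x - y‖ < ε := by simpa [dist_eq_norm] using hxy
    simpa using h1.trans h2.le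

-- Subtracting a finite rank approximant of `A - 1` from `A` leaves an operator within `1/2` of the
-- identity. That operator is invertible, and finite rank changes preserve the index.
open scoped LinearMap.FiniteRangeSetoid in
theorem isFredholm_and_index_of_isCompactOperator_sub_one [CompleteSpace E] {A : E →L[ℂ] E}
    (hA : IsCompactOperator (A - 1 : E →L[ℂ] E)) :
    A.IsFredholm ∧ A.toLinearMap.index = 0 := by
  obtain ⟨L, hL, hn⟩ := exists_finiteRange_norm_sub_le hA (half_pos one_pos)
  have hu : IsUnit (1 - (L - (A - 1))) := by
    apply isUnit_one_sub_of_norm_lt_one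
    rw [norm_sub_rev]
    linarith
  obtain ⟨u, hu⟩ := hu
  have heq : (u : E →L[ℂ] E).toLinearMap ≈ A.toLinearMap := by
    rw [LinearMap.FiniteRangeSetoid.equiv_iff_hasFiniteRange, hu]
    have h : (1 - (L - (A - 1)) : E →L[ℂ] E).toLinearMap - A.toLinearMap = -L.toLinearMap := by
      ext x; simp; abel
    rw [h]
    apply LinearMap.HasFiniteRange.neg
    rw [LinearMap.hasFiniteRange_iff_range, Submodule.fg_iff_finiteDimensional]
    exact hL
  have h1 : ((u⁻¹ : (E →L[ℂ] E)ˣ) : E →L[ℂ] E).toLinearMap ∘ₗ (u : E →L[ℂ] E).toLinearMap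
      = LinearMap.id := by
    ext x
    have := u.inv_mul
    exact congr($this x)
  have h2 : (u : E →L[ℂ] E).toLinearMap ∘ₗ ((u⁻¹ : (E →L[ℂ] E)ˣ) : E →L[ℂ] E).toLinearMap
      = LinearMap.id := by
    ext x
    have := u.mul_inv
    exact congr($this x)
  have hq : LinearMap.IsQuasiInverse ((u⁻¹ : (E →L[ℂ] E)ˣ) : E →L[ℂ] E).toLinearMap
      (u : E →L[ℂ] E).toLinearMap := by
    constructor
    · rw [LinearMap.IsLeftQuasiInverse, h1]
    · rw [LinearMap.IsRightQuasiInverse, h2]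
  have hqA := hq.congr (Setoid.refl _) (Setoid.symm heq)
  have hF : A.IsFredholm := .of_isQuasiInverse hqA
  have hFu : (u : E →L[ℂ] E).IsFredholm := .of_isQuasiInverse hq
  have := hF.finite_ker
  have := hF.finite_coker
  have := hFu.finite_ker
  have := hFu.finite_coker
  refine ⟨hF, ?_⟩
  rw [← index_eq_of_equiv heq]
  exact LinearEquiv.index_eq_zero (e := LinearEquiv.ofLinearMap _ _ h2 h1)

open scoped LinearMap.FiniteRangeSetoid in
/-- An operator that is invertible modulo the compact operators is Fredholm. -/
theorem isFredholm_of_isCompactOperator_comp_sub_one [CompleteSpace E] [CompleteSpace G]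
    {A : E →L[ℂ] G} {B : G →L[ℂ] E}
    (h1 : IsCompactOperator (B ∘L A - 1 : E →L[ℂ] E))
    (h2 : IsCompactOperator (A ∘L B - 1 : G →L[ℂ] G)) : A.IsFredholm := by
  obtain ⟨v, hv⟩ := (isFredholm_and_index_of_isCompactOperator_sub_one h1).1.exists_isQuasiInverse
  obtain ⟨w, hw⟩ := (isFredholm_and_index_of_isCompactOperator_sub_one h2).1.exists_isQuasiInverse
  have hl : (v ∘L B).toLinearMap ∘ₗ A.toLinearMap ≈ LinearMap.id := hv.1.equiv
  have hr : A.toLinearMap ∘ₗ (B ∘L w).toLinearMap ≈ LinearMap.id := hw.2.equiv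
  refine .of_isQuasiInverse (v := B ∘L w) ⟨?_, hr⟩
  -- As in any ring, a left and a right inverse coincide, here modulo finite rank.
  have h3 : (v ∘L B).toLinearMap ≈ (B ∘L w).toLinearMap :=
    calc (v ∘L B).toLinearMap = (v ∘L B).toLinearMap ∘ₗ LinearMap.id := rfl
      _ ≈ (v ∘L B).toLinearMap ∘ₗ (A.toLinearMap ∘ₗ (B ∘L w).toLinearMap) := by grw [hr]
      _ = ((v ∘L B).toLinearMap ∘ₗ A.toLinearMap) ∘ₗ (B ∘L w).toLinearMap := rfl
      _ ≈ LinearMap.id ∘ₗ (B ∘L w).toLinearMap := by grw [hl]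
      _ = (B ∘L w).toLinearMap := rfl
  exact Setoid.trans (LinearMap.FiniteRangeSetoid.equiv_comp_right (Setoid.symm h3)) hl

/-- Since the range is closed, the cokernel is its orthogonal complement, which is the kernel of the
adjoint. -/
theorem index_eq_finrank_ker_sub_finrank_ker_adjoint [CompleteSpace E] [CompleteSpace G]
    {A : E →L[ℂ] G} (hA : A.IsFredholm) :
    A.toLinearMap.index = (finrank ℂ A.ker : ℤ) - (finrank ℂ (adjoint A).ker : ℤ) := by
  have : CompleteSpace A.range := hA.isClosed_range.completeSpace_coe
  have e := Submodule.quotientEquivOfIsCompl A.range A.rangeᗮ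
    (Submodule.isCompl_orthogonal _)
  rw [LinearMap.index_eq_finrank_sub, e.finrank_eq, ContinuousLinearMap.orthogonal_range]

/-- If `A*A` is compact then so is `A`. -/
theorem isCompactOperator_of_adjoint_comp_self [CompleteSpace E] [CompleteSpace G]
    {A : E →L[ℂ] G} (hA : IsCompactOperator (adjoint A ∘L A : E →L[ℂ] E)) :
    IsCompactOperator A := by
  refine (isCompactOperator_iff_isCompact_closure_image_closedBall A.toLinearMap one_pos).mpr
    ((TotallyBounded.closure ?_).isCompact_of_isClosed isClosed_closure)
  have hc := (hA.isCompact_closure_image_closedBall 1).totallyBounded.subset subset_closure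
  rw [Metric.totallyBounded_iff]
  intro ε hε
  -- The radius `ε² / 2` suits `‖Az‖² ≤ ‖A*Az‖ ‖z‖`, where `‖z‖ ≤ 2` for a difference of points of
  -- the unit ball.
  obtain ⟨t, hts, ht, hcov⟩ := hc.exists_subset (Metric.dist_mem_uniformity
    (show 0 < ε ^ 2 / 2 by positivity))
  obtain ⟨s, hs, hs', rfl⟩ := Set.exists_subset_image_finite_and.mp ⟨t, hts, ht, rfl⟩
  refine ⟨A '' s, hs'.image _, ?_⟩
  rintro _ ⟨x, hx, rfl⟩
  obtain ⟨_, ⟨y, hy, rfl⟩, hxy⟩ := Set.mem_iUnion₂.mp (hcov ⟨x, hx, rfl⟩)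
  refine Set.mem_iUnion₂.mpr ⟨A y, ⟨y, hy, rfl⟩, ?_⟩
  have h1 : ‖adjoint A (A (x - y))‖ < ε ^ 2 / 2 := by
    simpa [dist_eq_norm] using hxy
  have h2 : ‖x - y‖ ≤ 2 := by
    have hx1 : ‖x‖ ≤ 1 := by simpa using hx
    have hy1 : ‖y‖ ≤ 1 := by simpa using hs hy
    linarith [norm_sub_le x y]
  have h3 : ‖A (x - y)‖ ^ 2 ≤ ‖adjoint A (A (x - y))‖ * ‖x - y‖ := by
    have h := ContinuousLinearMap.apply_norm_sq_eq_inner_adjoint_left A (x - y)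
    rw [h]
    exact (re_inner_le_norm _ _)
  have h4 : ‖A (x - y)‖ ^ 2 < ε ^ 2 := by
    nlinarith [norm_nonneg (x - y), norm_nonneg (adjoint A (A (x - y)))]
  have h5 := lt_of_pow_lt_pow_left₀ 2 hε.le h4
  simpa [dist_eq_norm] using h5

end Fredholm

/-! ### Relative dimension of pairs of subspaces -/

section RelIndex

variable {H : Type*} [NormedAddCommGroup H] [InnerProductSpace ℂ H] [CompleteSpace H]

/-- The relative dimension of two closed subspaces. -/
def relIndex (V W : Submodule ℂ H) : ℤ :=
  (finrank ℂ (V ⊓ Wᗮ : Submodule ℂ H) : ℤ) - (finrank ℂ (W ⊓ Vᗮ : Submodule ℂ H) : ℤ)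

/-- The orthogonal projection onto `W`, restricted to `V`. -/
def compress (V W : Submodule ℂ H) [W.HasOrthogonalProjection] : V →L[ℂ] W :=
  W.orthogonalProjectionOnto ∘L V.subtypeL

omit [CompleteSpace H] in
theorem relIndex_swap (V W : Submodule ℂ H) : relIndex W V = -relIndex V W := by
  simp [relIndex]

variable {V W X : Submodule ℂ H} [V.HasOrthogonalProjection] [W.HasOrthogonalProjection]
  [X.HasOrthogonalProjection]

theorem adjoint_compress [CompleteSpace V] [CompleteSpace W] :
    adjoint (compress V W) = compress W V := by
  rw [compress, compress, adjoint_comp, Submodule.adjoint_subtypeL,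
    Submodule.adjoint_orthogonalProjectionOnto]

omit [CompleteSpace H] [V.HasOrthogonalProjection] in
theorem finrank_ker_compress :
    finrank ℂ (compress V W).ker = finrank ℂ (V ⊓ Wᗮ : Submodule ℂ H) := by
  have h : (compress V W).ker.map V.subtype = V ⊓ Wᗮ := by
    ext x
    simp [compress, Submodule.mem_map, and_comm]
  rw [← h, LinearEquiv.finrank_eq (Submodule.equivMapOfInjective _ V.injective_subtype _)]

-- The compression in the opposite direction is an inverse modulo compact operators.
omit [CompleteSpace H] in
theorem isFredholm_compress [CompleteSpace V] [CompleteSpace W]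
    (h : IsCompactOperator (V.starProjection - W.starProjection : H →L[ℂ] H)) :
    (compress V W).IsFredholm := by
  have key : ∀ (V W : Submodule ℂ H) [V.HasOrthogonalProjection] [W.HasOrthogonalProjection],
      IsCompactOperator (V.starProjection - W.starProjection : H →L[ℂ] H) →
      IsCompactOperator (compress W V ∘L compress V W - 1 : V →L[ℂ] V) := by
    intro V W _ _ h
    have := (h.neg.comp_clm V.subtypeL).clm_comp V.orthogonalProjectionOnto
    refine isCompactOperator_of_forall_eq this fun x => ?_
    simp [compress]
  refine isFredholm_of_isCompactOperator_comp_sub_one (key V W h) (key W V ?_)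
  exact isCompactOperator_of_forall_eq h.neg fun x => by simp

theorem index_compress [CompleteSpace V] [CompleteSpace W]
    (h : IsCompactOperator (V.starProjection - W.starProjection : H →L[ℂ] H)) :
    (compress V W).toLinearMap.index = relIndex V W := by
  rw [index_eq_finrank_ker_sub_finrank_ker_adjoint (isFredholm_compress h), adjoint_compress,
    finrank_ker_compress, finrank_ker_compress, relIndex]

/-- The round trip `V → W → X → V` is a compact perturbation of the identity, so the three indices
add up to zero. -/
theorem relIndex_triangle [CompleteSpace V] [CompleteSpace W] [CompleteSpace X]
    (hVW : IsCompactOperator (V.starProjection - W.starProjection : H →L[ℂ] H))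
    (hWX : IsCompactOperator (W.starProjection - X.starProjection : H →L[ℂ] H)) :
    relIndex V X = relIndex V W + relIndex W X := by
  have hXV : IsCompactOperator (X.starProjection - V.starProjection : H →L[ℂ] H) := by
    exact isCompactOperator_of_forall_eq (hVW.add hWX).neg fun x => by simp
  have hc : IsCompactOperator
      (compress X V ∘L compress W X ∘L compress V W - 1 : V →L[ℂ] V) := by
    have h1 := (hVW.neg.clm_comp X.starProjection).add hXV
    have := (h1.comp_clm V.subtypeL).clm_comp V.orthogonalProjectionOnto
    refine isCompactOperator_of_forall_eq this fun x => ?_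
    simp [compress]
  have h0 := (isFredholm_and_index_of_isCompactOperator_sub_one hc).2
  have f1 := isFredholm_compress hVW
  have f2 := isFredholm_compress hWX
  have f3 := isFredholm_compress hXV
  have := f1.finite_ker
  have := f1.finite_coker
  have := f2.finite_ker
  have := f2.finite_coker
  have := f3.finite_ker
  have := f3.finite_coker
  have e1 := LinearMap.index_comp (f := (compress V W).toLinearMap) (compress W X).toLinearMap
  have : FiniteDimensional ℂ
      ((compress W X).toLinearMap ∘ₗ (compress V W).toLinearMap).ker := by
    rw [LinearMap.ker_comp]; infer_instance
  have : FiniteDimensional ℂ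
      (X ⧸ ((compress W X).toLinearMap ∘ₗ (compress V W).toLinearMap).range) := by
    rw [LinearMap.range_comp]; infer_instance
  have e2 := LinearMap.index_comp
    (f := (compress W X).toLinearMap ∘ₗ (compress V W).toLinearMap) (compress X V).toLinearMap
  have e3 : ((compress X V).toLinearMap ∘ₗ
      ((compress W X).toLinearMap ∘ₗ (compress V W).toLinearMap)).index = 0 := h0
  rw [index_compress hVW, index_compress hWX] at e1
  rw [e3, e1, index_compress hXV, relIndex_swap V X] at e2
  linarith

-- The difference of the projections fixes every vector of the intersection, so a nonzero one would
-- force norm at least one.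
omit [CompleteSpace H] in
theorem inf_orthogonal_eq_bot_of_norm_sub_lt_one
    (h : ‖V.starProjection - W.starProjection‖ < 1) : V ⊓ Wᗮ = ⊥ := by
  rw [Submodule.eq_bot_iff]
  rintro x ⟨hV, hW⟩
  by_contra hx
  have h1 : (V.starProjection - W.starProjection) x = x := by
    have h2 : W.starProjection x = 0 := by
      exact (Submodule.starProjection_apply_eq_zero_iff _).mpr hW
    simp [Submodule.starProjection_eq_self_iff.mpr hV, h2]
  have h3 := (V.starProjection - W.starProjection).le_opNorm x
  rw [h1] at h3
  have := norm_pos_iff.mpr hx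
  nlinarith

omit [CompleteSpace H] in
theorem relIndex_eq_zero_of_norm_sub_lt_one
    (h : ‖V.starProjection - W.starProjection‖ < 1) : relIndex V W = 0 := by
  rw [relIndex, inf_orthogonal_eq_bot_of_norm_sub_lt_one h,
    inf_orthogonal_eq_bot_of_norm_sub_lt_one (by rwa [norm_sub_rev])]
  simp

/-- The relative dimension vanishes along norm continuous families of projections. -/
theorem relIndex_eq_zero_of_continuousOn {V : ℝ → Submodule ℂ H}
    [∀ t, (V t).HasOrthogonalProjection] [∀ t, CompleteSpace (V t)] {S : Set ℝ}
    (hS : IsPreconnected S)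
    (hc : ContinuousOn (fun t => (V t).starProjection) S)
    (hK : ∀ s ∈ S, ∀ t ∈ S,
      IsCompactOperator ((V s).starProjection - (V t).starProjection : H →L[ℂ] H))
    {a b : ℝ} (ha : a ∈ S) (hb : b ∈ S) : relIndex (V a) (V b) = 0 := by
  -- An integer-valued function is continuous once it is locally constant; additivity reduces this
  -- to projections at distance less than one.
  have hf : ContinuousOn (fun t => relIndex (V a) (V t)) S := by
    intro t ht
    have hev := (hc t ht).eventually (Metric.ball_mem_nhds _ one_pos)
    refine (tendsto_const_nhds (x := relIndex (V a) (V t))).congr' ?_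
    filter_upwards [hev, self_mem_nhdsWithin] with s hs hsS
    rw [relIndex_triangle (hK a ha t ht) (hK t ht s hsS),
      relIndex_eq_zero_of_norm_sub_lt_one (V := V t) (W := V s), add_zero]
    rw [norm_sub_rev]
    simpa [dist_eq_norm] using hs
  have h := hS.constant hf ha hb
  rw [← h]
  exact relIndex_eq_zero_of_norm_sub_lt_one (by simp)

omit [CompleteSpace H] in
theorem relIndex_of_le (h : W ≤ V) :
    relIndex V W = finrank ℂ (V.starProjection - W.starProjection).range := by
  have h1 : W ⊓ Vᗮ = ⊥ := by
    rw [Submodule.eq_bot_iff]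
    rintro x ⟨hW, hV⟩
    exact inner_self_eq_zero.mp (hV x (h hW))
  have h2 : (V.starProjection - W.starProjection).range = V ⊓ Wᗮ := by
    ext x
    constructor
    · rintro ⟨y, rfl⟩
      refine ⟨V.sub_mem (V.starProjection_apply_mem _) (h (W.starProjection_apply_mem _)), ?_⟩
      have e : (V.starProjection - W.starProjection) y =
          (y - W.starProjection y) - (y - V.starProjection y) := by simp
      exact e ▸ Submodule.sub_mem _ (W.sub_starProjection_mem_orthogonal y)
        (Submodule.orthogonal_le h (V.sub_starProjection_mem_orthogonal y))
    · rintro ⟨hV, hW⟩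
      refine ⟨x, ?_⟩
      have h2 : W.starProjection x = 0 := by
        exact (Submodule.starProjection_apply_eq_zero_iff _).mpr hW
      simp [Submodule.starProjection_eq_self_iff.mpr hV, h2]
  rw [relIndex, h1, h2]
  simp

end RelIndex

/-! ### Spectral projections through continuous functional calculus -/

section Spectral

variable {H : Type*} [NormedAddCommGroup H] [InnerProductSpace ℂ H] [CompleteSpace H]

/-- The range of the spectral projection `χ_{(-∞, c]}(A)`. -/
def specSubspace (A : H →L[ℂ] H) (c : ℝ) : Submodule ℂ H :=
  (cfc (fun x : ℝ => max (x - c) 0) A).ker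

instance (A : H →L[ℂ] H) (c : ℝ) : CompleteSpace (specSubspace A c) :=
  (ContinuousLinearMap.isClosed_ker _).completeSpace_coe

theorem isSelfAdjoint_spectralFamily (A : H →L[ℂ] H) (c : ℝ) :
    IsSelfAdjoint (spectralFamily A c) :=
  isSelfAdjoint_starProjection _

theorem spectralFamily_mul_self (A : H →L[ℂ] H) (c : ℝ) :
    spectralFamily A c * spectralFamily A c = spectralFamily A c :=
  (specSubspace A c).isIdempotentElem_starProjection

theorem spectralFamily_apply_of_mem {A : H →L[ℂ] H} {c : ℝ} {v : H}
    (hv : v ∈ specSubspace A c) : spectralFamily A c v = v :=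
  Submodule.starProjection_eq_self_iff.mpr hv

theorem spectralFamily_apply_mem (A : H →L[ℂ] H) (c : ℝ) (v : H) :
    spectralFamily A c v ∈ specSubspace A c :=
  Submodule.starProjection_apply_mem _ v

variable {A : H →L[ℂ] H}

theorem cfc_one_sub (hA : IsSelfAdjoint A) {f : ℝ → ℝ} (hf : Continuous f) :
    cfc (fun x => 1 - f x) A = 1 - cfc f A := by
  rw [cfc_sub (fun _ => 1) f A (by fun_prop) hf.continuousOn, cfc_const_one ℝ A]

/-- `f(A)` vanishes on the range of `χ_{(-∞, c]}(A)` if `f` is a multiple of `(x - c)₊`. -/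
theorem cfc_mul_spectralFamily_eq_zero {f g : ℝ → ℝ} {c : ℝ}
    (hg : Continuous g) (hf : ∀ x, f x = g x * max (x - c) 0) :
    cfc f A * spectralFamily A c = 0 := by
  have h : cfc f A = cfc g A * cfc (fun x : ℝ => max (x - c) 0) A := by
    rw [← cfc_mul g (fun x : ℝ => max (x - c) 0) A hg.continuousOn (by fun_prop)]
    exact congrArg (fun k => cfc k A) (funext hf)
  ext v
  have hv : cfc (fun x : ℝ => max (x - c) 0) A (spectralFamily A c v) = 0 :=
    spectralFamily_apply_mem A c v
  simp [h, hv]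

/-- The range of `f(A)` lies in the range of `χ_{(-∞, c]}(A)` if `f` vanishes to the right
of `c` on the spectrum. -/
theorem spectralFamily_mul_cfc {f : ℝ → ℝ} {c : ℝ} (hf : Continuous f)
    (h : ∀ x ∈ spectrum ℝ A, f x * max (x - c) 0 = 0) :
    spectralFamily A c * cfc f A = cfc f A := by
  have h0 : cfc (fun x : ℝ => max (x - c) 0) A * cfc f A = 0 := by
    rw [← cfc_mul (fun x : ℝ => max (x - c) 0) f A (by fun_prop) hf.continuousOn]
    rw [cfc_congr (g := fun _ => (0 : ℝ)) (fun x hx => by simpa [mul_comm] using h x hx)]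
    simp
  ext v
  exact spectralFamily_apply_of_mem congr($h0 v)

theorem cfc_mul_spectralFamily {f : ℝ → ℝ} {c : ℝ} (hf : Continuous f)
    (h : ∀ x ∈ spectrum ℝ A, f x * max (x - c) 0 = 0) :
    cfc f A * spectralFamily A c = cfc f A := by
  have h1 := congrArg star (spectralFamily_mul_cfc hf h)
  rwa [star_mul, (isSelfAdjoint_spectralFamily A c).star_eq,
    (cfc_predicate f A : IsSelfAdjoint (cfc f A)).star_eq] at h1

theorem spectralFamily_mul_cfc_eq_zero {f g : ℝ → ℝ} {c : ℝ}
    (hg : Continuous g) (hf : ∀ x, f x = g x * max (x - c) 0) :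
    spectralFamily A c * cfc f A = 0 := by
  have h1 := congrArg star (cfc_mul_spectralFamily_eq_zero (A := A) hg hf)
  rwa [star_mul, (isSelfAdjoint_spectralFamily A c).star_eq,
    (cfc_predicate f A : IsSelfAdjoint (cfc f A)).star_eq, star_zero] at h1

/-- For `c < d`, `(x - d)₊` is a continuous multiple of `(x - c)₊`, so the kernels are nested. -/
theorem specSubspace_mono {c d : ℝ} (h : c ≤ d) : specSubspace A c ≤ specSubspace A d := by
  rcases h.eq_or_lt with rfl | h
  · rfl
  have h0 := cfc_mul_spectralFamily_eq_zero (A := A) (c := c) (f := fun x => max (x - d) 0)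
    (g := fun x => max (x - d) 0 / max (x - c) (d - c))
    (Continuous.div (by fun_prop) (by fun_prop) fun x =>
      (lt_of_lt_of_le (sub_pos.mpr h) (le_max_right _ _)).ne') (fun x => by
      rcases le_total x d with hx | hx
      · simp [max_eq_right (sub_nonpos.mpr hx)]
      · have : 0 < x - c := by linarith
        rw [max_eq_left (by linarith : d - c ≤ x - c), max_eq_left this.le]
        field_simp)
  intro v hv
  have := congr($h0 v)
  rwa [mul_apply_eq_comp, spectralFamily_apply_of_mem hv] at this

/-- The continuous function that equals one on `(-∞, a]`, zero on `[b, ∞)`, and is affine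
in between. -/
def ramp (a b x : ℝ) : ℝ := 1 - max (x - a) 0 / max (b - a) (x - a)

theorem continuous_ramp {a b : ℝ} (h : a < b) : Continuous (ramp a b) := by
  unfold ramp
  exact continuous_const.sub (Continuous.div (by fun_prop) (by fun_prop) fun x =>
      (lt_of_lt_of_le (sub_pos.mpr h) (le_max_left _ _)).ne')

theorem ramp_mul_eq_zero {a b : ℝ} (h : a < b) (x : ℝ) : ramp a b x * max (x - b) 0 = 0 := by
  rcases le_total x b with hx | hx
  · simp [max_eq_right (sub_nonpos.mpr hx)]
  · have : 0 < x - a := by linarith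
    rw [ramp, max_eq_left this.le, max_eq_right (by linarith : b - a ≤ x - a), div_self this.ne']
    simp

theorem cfc_ramp_mul_spectralFamily_left (hA : IsSelfAdjoint A) {a b : ℝ} (h : a < b) :
    cfc (ramp a b) A * spectralFamily A a = spectralFamily A a := by
  have hc : Continuous fun x => 1 / max (b - a) (x - a) :=
    Continuous.div (by fun_prop) (by fun_prop) fun x =>
      (lt_of_lt_of_le (sub_pos.mpr h) (le_max_left _ _)).ne'
  have h0 := cfc_mul_spectralFamily_eq_zero (A := A) (c := a) (f := fun x => 1 - ramp a b x) hc
    (fun x => by simp only [ramp]; ring)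
  rw [cfc_one_sub hA (continuous_ramp h), sub_mul, sub_eq_zero] at h0
  simpa using h0.symm

/-- `χ_{(-∞, a]}(A)` in terms of a continuous function of `A` and `χ_{(a, b]}(A)`. -/
theorem cfc_ramp_mul_one_sub_spectralProj (hA : IsSelfAdjoint A) {a b : ℝ} (h : a < b) :
    cfc (ramp a b) A * (1 - spectralProj A a b) = spectralFamily A a := by
  rw [spectralProj, mul_sub, mul_sub, mul_one, cfc_ramp_mul_spectralFamily_left hA h,
    cfc_mul_spectralFamily (continuous_ramp h) fun x _ => ramp_mul_eq_zero h x]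
  abel

/-- The ramp takes only the values `0` and `1` off the gap, so in a gap the spectral projection is a
continuous function of the operator. -/
theorem cfc_ramp_eq_spectralFamily (hA : IsSelfAdjoint A) {a b : ℝ} (h : a < b)
    (hs : Disjoint (spectrum ℝ A) (Set.Icc a b)) :
    cfc (ramp a b) A = spectralFamily A a := by
  rw [← cfc_ramp_mul_spectralFamily_left hA h]
  refine (cfc_mul_spectralFamily (continuous_ramp h) fun x hx => ?_).symm
  have hx' := Set.disjoint_left.mp hs hx
  rcases le_total x a with hxa | hxa
  · simp [max_eq_right (sub_nonpos.mpr hxa)]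
  · have hbx : b ≤ x := by
      by_contra hb
      exact hx' ⟨hxa, (not_le.mp hb).le⟩
    have : 0 < x - a := by linarith
    rw [ramp, max_eq_left this.le, max_eq_right (by linarith : b - a ≤ x - a), div_self this.ne']
    simp

/-- The bump `u = (b - x)₊ (x - a)₊` gives `u(A) = u(A) E_b = u(A) E_a = 0`, while `u` is positive
on the open interval; spectral mapping concludes. -/
theorem disjoint_spectrum_Ioo (hA : IsSelfAdjoint A) {a b : ℝ}
    (h : spectralFamily A a = spectralFamily A b) :
    Disjoint (spectrum ℝ A) (Set.Ioo a b) := by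
  set u : ℝ → ℝ := fun x => max (b - x) 0 * max (x - a) 0 with hu
  have h1 : cfc u A = 0 := by
    have hc : Continuous u := by fun_prop
    rw [← cfc_mul_spectralFamily (c := b) hc, ← h]
    · exact cfc_mul_spectralFamily_eq_zero (g := fun x => max (b - x) 0) (by fun_prop)
        fun x => rfl
    · intro x _
      rcases le_total x b with hx | hx
      · simp [max_eq_right (sub_nonpos.mpr hx)]
      · simp [hu, max_eq_right (sub_nonpos.mpr hx)]
  have h2 := cfc_map_spectrum u A hA (by fun_prop)
  rw [Set.disjoint_left]
  rintro x hx ⟨hax, hxb⟩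
  have h3 : u x ∈ spectrum ℝ (cfc u A) := h2 ▸ ⟨x, hx, rfl⟩
  rw [h1] at h3
  have : Nontrivial (H →L[ℂ] H) := by
    by_contra hn
    rw [not_nontrivial_iff_subsingleton] at hn
    simp at h3
  rw [spectrum.zero_eq, Set.mem_singleton_iff] at h3
  have h4 : 0 < u x := by
    rw [hu]
    simp only [max_eq_left (sub_pos.mpr hax).le, max_eq_left (sub_pos.mpr hxb).le]
    exact mul_pos (sub_pos.mpr hxb) (sub_pos.mpr hax)
  exact h4.ne' h3

theorem continuousOn_cfc_comp {γ : ℝ → H →L[ℂ] H} {S : Set ℝ} (hγ : ContinuousOn γ S)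
    (hsa : ∀ t ∈ S, IsSelfAdjoint (γ t)) {f : ℝ → ℝ} (hf : Continuous f) :
    ContinuousOn (fun t => cfc f (γ t)) S :=
  ContinuousOn.cfc_of_mem_nhdsSet (s := Set.univ) f Filter.univ_mem hγ hsa hf.continuousOn

/-- Admissible data control only `E_b - E_a`. Multiplying `1 - (E_b - E_a)` by the ramp isolates
`E_a`. -/
theorem continuousOn_spectralFamily_of_spectralProj {γ : ℝ → H →L[ℂ] H} {S : Set ℝ}
    (hγ : ContinuousOn γ S) (hsa : ∀ t ∈ S, IsSelfAdjoint (γ t)) {a b : ℝ} (hab : a < b)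
    (h : ContinuousOn (fun t => spectralProj (γ t) a b) S) :
    ContinuousOn (fun t => spectralFamily (γ t) a) S :=
  ((continuousOn_cfc_comp hγ hsa (continuous_ramp hab)).mul (continuousOn_const.sub h)).congr
    fun t ht => (cfc_ramp_mul_one_sub_spectralProj (hsa t ht) hab).symm

/-- The spectral projection is locally continuous in a gap of the spectrum. -/
theorem exists_isOpen_continuousOn_spectralFamily {γ : ℝ → H →L[ℂ] H} {S : Set ℝ}
    (hγ : ContinuousOn γ S) (hsa : ∀ t ∈ S, IsSelfAdjoint (γ t)) {t₀ : ℝ} (ht₀ : t₀ ∈ S)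
    {a b : ℝ} (hab : a < b) (hs : Disjoint (spectrum ℝ (γ t₀)) (Set.Icc a b)) :
    ∃ O : Set ℝ, IsOpen O ∧ t₀ ∈ O ∧
      ContinuousOn (fun t => spectralFamily (γ t) a) (O ∩ S) := by
  -- Upper hemicontinuity of the spectrum keeps the gap free for nearby operators.
  have hev : ∀ᶠ B in nhds (γ t₀), (Set.Icc a b)ᶜ ∈ nhdsSet (spectrum ℝ B) :=
    (upperHemicontinuous_spectrum ℝ (H →L[ℂ] H)).upperHemicontinuousAt _ _
      (isClosed_Icc.isOpen_compl.mem_nhdsSet.mpr (Set.disjoint_left.mp hs))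
  have h1 := (hγ t₀ ht₀).eventually hev
  obtain ⟨O, hO, htO, hsub⟩ := mem_nhdsWithin.mp h1
  refine ⟨O, hO, htO, ?_⟩
  refine (continuousOn_cfc_comp (hγ.mono Set.inter_subset_right)
    (fun t ht => hsa t ht.2) (continuous_ramp hab)).congr fun t ht => ?_
  exact (cfc_ramp_eq_spectralFamily (hsa t ht.2) hab
    (Set.disjoint_left.mpr (subset_of_mem_nhdsSet (hsub ht)))).symm

/-! ### Compact perturbations of a symmetry -/

section Compact

variable {P : H →L[ℂ] H}

/-- If `A` is a compact perturbation of `2P - 1` and `-1 < c < 1`, then `χ_{(-∞, c]}(A)` is a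
compact perturbation of `1 - P`. -/
theorem isCompactOperator_spectralFamily_sub (hA : IsSelfAdjoint A) (hP : P * P = P)
    (hK : IsCompactOperator (A - (2 * P - 1) : H →L[ℂ] H)) {c : ℝ} (hc : c ∈ Set.Ioo (-1 : ℝ) 1) :
    IsCompactOperator (spectralFamily A c - (1 - P) : H →L[ℂ] H) := by
  set K := A - (2 * P - 1) with hKdef
  set R := spectralFamily A c with hR
  have h1c : 0 < 1 - c := by linarith [hc.2]
  have h2c : 0 < c + 1 := by linarith [hc.1]
  -- On `(-∞, c]` this is `1 / (1 - x)`, and `k` below is `1 / (x + 1)` on `[c, ∞)`; the truncations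
  -- keep both continuous. Thus `1 - A` is inverted on the range of `R` and `A + 1` on that of `1 -
  -- R`.
  set g : ℝ → ℝ := fun x => 1 / max (1 - x) (1 - c) with hg
  have hgc : Continuous g := Continuous.div (by fun_prop) (by fun_prop) fun x =>
      (lt_of_lt_of_le h1c (le_max_right _ _)).ne'
  set k : ℝ → ℝ := fun x => 1 / max (x + 1) (c + 1) with hk
  have hkc : Continuous k := Continuous.div (by fun_prop) (by fun_prop) fun x =>
      (lt_of_lt_of_le h2c (le_max_right _ _)).ne'
  have e1 : R = R * cfc g A * (1 - A) := by
    have h0 := spectralFamily_mul_cfc_eq_zero (A := A) (c := c)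
      (f := fun x => 1 - g x * (1 - x)) (g := fun _ => 1 / (1 - c)) (by fun_prop) (fun x => by
        simp only [hg]
        rcases le_total x c with hx | hx
        · have : 0 < 1 - x := by linarith
          rw [max_eq_left (by linarith : 1 - c ≤ 1 - x), max_eq_right (by linarith)]
          field_simp
          ring
        · rw [max_eq_right (by linarith : 1 - x ≤ 1 - c), max_eq_left (by linarith)]
          field_simp
          ring)
    rw [cfc_one_sub hA (f := fun x => g x * (1 - x)) (by fun_prop),
      cfc_mul g (fun x => 1 - x) A hgc.continuousOn (by fun_prop),
      cfc_one_sub hA (f := fun x => x) (by fun_prop), cfc_id' ℝ A, mul_sub, sub_eq_zero] at h0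
    simpa [mul_assoc] using h0
  have e2 : 1 - R = (1 - R) * cfc k A * (A + 1) := by
    have h0 := spectralFamily_mul_cfc (A := A) (c := c)
      (f := fun x => 1 - k x * (x + 1)) (by fun_prop) (fun x _ => by
        simp only [hk]
        rcases le_total x c with hx | hx
        · rw [max_eq_right (sub_nonpos.mpr hx), mul_zero]
        · have : 0 < x + 1 := by linarith
          rw [max_eq_left (by linarith : c + 1 ≤ x + 1)]
          field_simp
          ring)
    rw [cfc_one_sub hA (f := fun x => k x * (x + 1)) (by fun_prop),
      cfc_mul k (fun x => x + 1) A hkc.continuousOn (by fun_prop),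
      cfc_add_const 1 (fun x => x) A (by fun_prop), cfc_id' ℝ A] at h0
    simp only [map_one] at h0
    have h1 : (1 - R) * (1 - cfc k A * (A + 1)) = 0 := by
      rw [sub_mul, h0, one_mul, sub_self]
    rw [mul_sub, mul_one, sub_eq_zero] at h1
    rw [mul_assoc]
    exact h1
  have hAK : A = K + (2 * P - 1) := by rw [hKdef]; abel
  have e3 : (1 - A) * P = -(K * P) := by
    rw [hAK]
    have : (1 - (K + (2 * P - 1))) * P = 2 * P - K * P - 2 * (P * P) := by noncomm_ring
    rw [this, hP]; abel
  have e4 : (A + 1) * (1 - P) = K * (1 - P) := by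
    rw [hAK]
    have : (K + (2 * P - 1) + 1) * (1 - P) = K * (1 - P) + (2 * P - 2 * (P * P)) := by
      noncomm_ring
    rw [this, hP]; abel
  -- Both `(1 - A)P` and `(A + 1)(1 - P)` carry the compact factor `K`, because `2P - 1` is `1` on
  -- the range of `P` and `-1` on that of `1 - P`.
  have e5 : R - (1 - P) = -(R * cfc g A * (K * P)) - (1 - R) * cfc k A * (K * (1 - P)) := by
    calc R - (1 - P) = R * P - (1 - R) * (1 - P) := by noncomm_ring
      _ = R * cfc g A * ((1 - A) * P) - (1 - R) * cfc k A * ((A + 1) * (1 - P)) := by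
        rw [← mul_assoc, ← mul_assoc, ← e1, ← e2]
      _ = _ := by rw [e3, e4]; noncomm_ring
  rw [e5]
  have c1 := ((hK.comp_clm P).clm_comp (R * cfc g A)).neg
  have c2 := (hK.comp_clm (1 - P)).clm_comp ((1 - R) * cfc k A)
  exact c1.sub c2

end Compact

end Spectral

/-! ### Spectral flow as a relative dimension of the end points -/

section Path

variable {H : Type*} [NormedAddCommGroup H] [InnerProductSpace ℂ H] [CompleteSpace H]

theorem isCompactOperator_spectralFamily_sub_spectralFamily {A B P : H →L[ℂ] H}
    (hA : IsSelfAdjoint A) (hB : IsSelfAdjoint B) (hP : P * P = P)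
    (hKA : IsCompactOperator (A - (2 * P - 1) : H →L[ℂ] H))
    (hKB : IsCompactOperator (B - (2 * P - 1) : H →L[ℂ] H))
    {c d : ℝ} (hc : c ∈ Set.Ioo (-1 : ℝ) 1) (hd : d ∈ Set.Ioo (-1 : ℝ) 1) :
    IsCompactOperator (spectralFamily A c - spectralFamily B d : H →L[ℂ] H) :=
  isCompactOperator_of_forall_eq ((isCompactOperator_spectralFamily_sub hA hP hKA hc).sub
    (isCompactOperator_spectralFamily_sub hB hP hKB hd)) fun x => by simp

theorem relIndex_specSubspace (A : H →L[ℂ] H) {a b : ℝ} (h : a ≤ b) :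
    relIndex (specSubspace A b) (specSubspace A a) = finrank ℂ (spectralProj A a b).range :=
  relIndex_of_le (specSubspace_mono h)

theorem spectralProj_mul_self (A : H →L[ℂ] H) {a b : ℝ} (h : a ≤ b) :
    spectralProj A a b * spectralProj A a b = spectralProj A a b := by
  have h1 : spectralFamily A b * spectralFamily A a = spectralFamily A a := by
    ext v
    exact spectralFamily_apply_of_mem (specSubspace_mono h (spectralFamily_apply_mem A a v))
  have h2 := congrArg star h1
  rw [star_mul, (isSelfAdjoint_spectralFamily A a).star_eq,
    (isSelfAdjoint_spectralFamily A b).star_eq] at h2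
  rw [spectralProj, mul_sub, sub_mul, sub_mul, h1, h2, spectralFamily_mul_self,
    spectralFamily_mul_self]
  abel

section

variable {A P : H →L[ℂ] H} (hA : IsSelfAdjoint A) (hP : P * P = P)
  (hK : IsCompactOperator (A - (2 * P - 1) : H →L[ℂ] H))
include hA hP hK

/-- A compact idempotent has finite rank: its range lies in the eigenspace for `1`. -/
theorem finiteDimensional_range_spectralProj {a b : ℝ} (hab : a ≤ b)
    (ha : a ∈ Set.Ioo (-1 : ℝ) 1) (hb : b ∈ Set.Ioo (-1 : ℝ) 1) :
    FiniteDimensional ℂ (spectralProj A a b).range := by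
  have hc : IsCompactOperator (spectralProj A a b) :=
    isCompactOperator_spectralFamily_sub_spectralFamily hA hA hP hK hK hb ha
  have := ContinuousLinearMap.finite_dimensional_eigenspace hc (1 : ℂ) one_ne_zero
  refine Submodule.finiteDimensional_of_le
    (S₂ := Module.End.eigenspace (spectralProj A a b).toLinearMap (1 : ℂ)) ?_
  rintro _ ⟨v, rfl⟩
  rw [Module.End.mem_eigenspace_iff, one_smul]
  exact congr($(spectralProj_mul_self A hab) v)

-- The symmetry `2P - 1` is its own inverse, hence inverts `A` modulo compact operators.
omit hA in
theorem isFredholm_of_isCompactOperator_sub_symmetry : A.IsFredholm := by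
  have hF : (2 * P - 1) * (2 * P - 1) = 1 := by
    have : (2 * P - 1) * (2 * P - 1) = 4 * (P * P) - 4 * P + 1 := by noncomm_ring
    rw [this, hP]; abel
  generalize 2 * P - 1 = F at hF hK
  refine isFredholm_of_isCompactOperator_comp_sub_one (B := F) ?_ ?_
  · have e : F * A - 1 = F * (A - F) := by rw [mul_sub, hF]
    exact isCompactOperator_of_forall_eq (hK.clm_comp F) (DFunLike.congr_fun e)
  · have e : A * F - 1 = (A - F) * F := by rw [sub_mul, hF]
    exact isCompactOperator_of_forall_eq (hK.comp_clm F) (DFunLike.congr_fun e)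

/-- Every interval inside the essential gap contains a gap of the spectrum. -/
theorem exists_Icc_disjoint_spectrum {l r : ℝ} (hlr : l < r) (hl : -1 < l) (hr : r < 1) :
    ∃ a b, l < a ∧ a < b ∧ b < r ∧ Disjoint (spectrum ℝ A) (Set.Icc a b) := by
  classical
  -- Choose `c` minimizing the rank of `χ_{(c, r]}(A)`. Moving `c` to the right then cannot lower
  -- the rank, so `χ_{(c, d]}(A) = 0`.
  have hne : ∃ n : ℕ, ∃ c ∈ Set.Ioo l r, finrank ℂ (spectralProj A c r).range = n :=
    ⟨_, (l + r) / 2, ⟨by linarith, by linarith⟩, rfl⟩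
  obtain ⟨c, hc, hcn⟩ := Nat.find_spec hne
  have hmin : ∀ d ∈ Set.Ioo l r,
      finrank ℂ (spectralProj A c r).range ≤ finrank ℂ (spectralProj A d r).range := by
    intro d hd
    rw [hcn]
    exact Nat.find_min' hne ⟨d, hd, rfl⟩
  set d := (c + r) / 2 with hd
  have hcd : c < d := by rw [hd]; linarith [hc.2]
  have hdr : d < r := by rw [hd]; linarith [hc.2]
  have mc : c ∈ Set.Ioo (-1 : ℝ) 1 := ⟨by linarith [hc.1], by linarith [hc.2]⟩
  have md : d ∈ Set.Ioo (-1 : ℝ) 1 := ⟨by linarith [hc.1], by linarith⟩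
  have mr : r ∈ Set.Ioo (-1 : ℝ) 1 := ⟨by linarith, hr⟩
  have h1 := hmin d ⟨by linarith [hc.1], hdr⟩
  have h2 : relIndex (specSubspace A r) (specSubspace A c) = relIndex (specSubspace A r)
      (specSubspace A d) + relIndex (specSubspace A d) (specSubspace A c) :=
    relIndex_triangle
      (isCompactOperator_spectralFamily_sub_spectralFamily hA hA hP hK hK mr md)
      (isCompactOperator_spectralFamily_sub_spectralFamily hA hA hP hK hK md mc)
  rw [relIndex_specSubspace A hc.2.le, relIndex_specSubspace A hdr.le,
    relIndex_specSubspace A hcd.le] at h2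
  have h3 : finrank ℂ (spectralProj A c d).range = 0 := by omega
  have := finiteDimensional_range_spectralProj hA hP hK hcd.le mc md
  have h4 : spectralProj A c d = 0 := by
    have := Submodule.finrank_eq_zero.mp h3
    ext v
    have hv : spectralProj A c d v ∈ (spectralProj A c d).range := ⟨v, rfl⟩
    rw [this] at hv
    exact hv
  have h5 := disjoint_spectrum_Ioo hA (sub_eq_zero.mp h4).symm
  refine ⟨(2 * c + d) / 3, (c + 2 * d) / 3, by linarith [hc.1], by linarith, by linarith,
    h5.mono_right (Set.Icc_subset_Ioo (by linarith) (by linarith))⟩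

end

section

variable {γ : ℝ → H →L[ℂ] H} {P : H →L[ℂ] H} (hγ : ContinuousOn γ (Set.Icc 0 1))
  (hsa : ∀ t ∈ Set.Icc (0 : ℝ) 1, IsSelfAdjoint (γ t)) (hP : P * P = P)
  (hK : ∀ t ∈ Set.Icc (0 : ℝ) 1, IsCompactOperator (γ t - (2 * P - 1) : H →L[ℂ] H))
include hsa hP hK

theorem relIndex_specSubspace_eq_zero {c u v : ℝ} (hc : c ∈ Set.Ioo (-1 : ℝ) 1)
    (huv : Set.Icc u v ⊆ Set.Icc 0 1)
    (h : ContinuousOn (fun t => spectralFamily (γ t) c) (Set.Icc u v))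
    {s t : ℝ} (hs : s ∈ Set.Icc u v) (ht : t ∈ Set.Icc u v) :
    relIndex (specSubspace (γ s) c) (specSubspace (γ t) c) = 0 :=
  relIndex_eq_zero_of_continuousOn (V := fun t => specSubspace (γ t) c) isPreconnected_Icc h
    (fun s hs t ht => isCompactOperator_spectralFamily_sub_spectralFamily (hsa s (huv hs))
      (hsa t (huv ht)) hP (hK s (huv hs)) (hK t (huv ht)) hc hc) hs ht

theorem relIndex_specSubspace_triangle {s t u : ℝ} {a b c : ℝ} (hs : s ∈ Set.Icc (0 : ℝ) 1)
    (ht : t ∈ Set.Icc (0 : ℝ) 1) (hu : u ∈ Set.Icc (0 : ℝ) 1)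
    (ha : a ∈ Set.Ioo (-1 : ℝ) 1) (hb : b ∈ Set.Ioo (-1 : ℝ) 1) (hc : c ∈ Set.Ioo (-1 : ℝ) 1) :
    relIndex (specSubspace (γ s) a) (specSubspace (γ u) c) =
      relIndex (specSubspace (γ s) a) (specSubspace (γ t) b) +
      relIndex (specSubspace (γ t) b) (specSubspace (γ u) c) :=
  relIndex_triangle
    (isCompactOperator_spectralFamily_sub_spectralFamily (hsa s hs) (hsa t ht) hP
      (hK s hs) (hK t ht) ha hb)
    (isCompactOperator_spectralFamily_sub_spectralFamily (hsa t ht) (hsa u hu) hP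
      (hK t ht) (hK u hu) hb hc)

include hγ

/-- Zero itself may be in the spectrum, so one gap is taken on each side of it. -/
theorem exists_isOpen_continuousOn_pair {t : ℝ} (ht : t ∈ Set.Icc (0 : ℝ) 1) :
    ∃ (O : Set ℝ) (a b : ℝ), IsOpen O ∧ t ∈ O ∧ a ∈ Set.Ioo (-1 : ℝ) 0 ∧ b ∈ Set.Ioo (0 : ℝ) 1 ∧
      ContinuousOn (fun t => spectralFamily (γ t) a) (O ∩ Set.Icc 0 1) ∧
      ContinuousOn (fun t => spectralFamily (γ t) b) (O ∩ Set.Icc 0 1) := by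
  obtain ⟨a, a', h1, h2, h3, h4⟩ := exists_Icc_disjoint_spectrum (hsa t ht) hP (hK t ht)
    (l := -1 / 2) (r := 0) (by norm_num) (by norm_num) (by norm_num)
  obtain ⟨b, b', h5, h6, h7, h8⟩ := exists_Icc_disjoint_spectrum (hsa t ht) hP (hK t ht)
    (l := 0) (r := 1 / 2) (by norm_num) (by norm_num) (by norm_num)
  obtain ⟨O, hO, htO, hOc⟩ := exists_isOpen_continuousOn_spectralFamily hγ hsa ht h2 h4
  obtain ⟨O', hO', htO', hOc'⟩ := exists_isOpen_continuousOn_spectralFamily hγ hsa ht h6 h8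
  exact ⟨O ∩ O', a, b, hO.inter hO', ⟨htO, htO'⟩, ⟨by linarith, by linarith⟩,
    ⟨h5, by linarith⟩, hOc.mono fun x hx => ⟨hx.1.1, hx.2⟩, hOc'.mono fun x hx => ⟨hx.1.2, hx.2⟩⟩

theorem exists_isAdmissible :
    ∃ (N : ℕ) (s : Fin (N + 1) → ℝ) (a b : Fin N → ℝ), IsAdmissible γ s a b := by
  choose! O a b hO hmem ha hb hca hcb using
    fun t ht => exists_isOpen_continuousOn_pair hγ hsa hP hK (t := t) ht
  -- A uniform partition finer than a Lebesgue number puts each closed piece inside one of the open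
  -- sets.
  obtain ⟨δ, hδ, hcov⟩ := lebesgue_number_lemma_of_metric (isCompact_Icc (a := (0 : ℝ)) (b := 1))
    (c := fun t : Set.Icc (0 : ℝ) 1 => O t) (fun t => hO t t.2)
    (fun t ht => Set.mem_iUnion.mpr ⟨⟨t, ht⟩, hmem t ht⟩)
  obtain ⟨N, hN⟩ := exists_nat_one_div_lt hδ
  have hN0 : (0 : ℝ) < N + 1 := by positivity
  set s : Fin (N + 1 + 1) → ℝ := fun i => (i : ℕ) / ((N : ℝ) + 1) with hs
  have hs01 : ∀ i, s i ∈ Set.Icc (0 : ℝ) 1 := by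
    intro i
    refine ⟨by positivity, ?_⟩
    rw [hs]
    simp only
    rw [div_le_one hN0]
    exact_mod_cast Nat.lt_succ_iff.mp i.2
  have hstep : ∀ n : Fin (N + 1), s n.succ = s n.castSucc + 1 / ((N : ℝ) + 1) := by
    intro n
    simp only [hs, Fin.val_succ, Fin.val_castSucc, Nat.cast_add, Nat.cast_one]
    ring
  choose i hi using fun n : Fin (N + 1) => hcov (s n.castSucc) (hs01 _)
  have hsub01 : ∀ n : Fin (N + 1), Set.Icc (s n.castSucc) (s n.succ) ⊆ Set.Icc 0 1 :=
    fun n => Set.Icc_subset_Icc (hs01 _).1 (hs01 _).2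
  have hsub : ∀ n : Fin (N + 1), Set.Icc (s n.castSucc) (s n.succ) ⊆ O (i n) ∩ Set.Icc 0 1 := by
    intro n x hx
    refine ⟨hi n ?_, hsub01 n hx⟩
    rw [hstep] at hx
    rw [Metric.mem_ball, Real.dist_eq, abs_of_nonneg (by linarith [hx.1])]
    linarith [hx.2]
  have ma : ∀ n, a (i n) ∈ Set.Ioo (-1 : ℝ) 1 := fun n =>
    ⟨(ha (i n) (i n).2).1, (ha (i n) (i n).2).2.trans one_pos⟩
  have mb : ∀ n, b (i n) ∈ Set.Ioo (-1 : ℝ) 1 := fun n =>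
    ⟨neg_one_lt_zero.trans (hb (i n) (i n).2).1, (hb (i n) (i n).2).2⟩
  have hab : ∀ n, a (i n) ≤ b (i n) := fun n =>
    (ha (i n) (i n).2).2.le.trans (hb (i n) (i n).2).1.le
  refine ⟨N + 1, s, fun n => a (i n), fun n => b (i n), ?_, ?_, ?_, fun n => ha _ (i n).2,
    fun n => hb _ (i n).2, fun n => ?_, fun n => ?_⟩
  · intro x y hxy
    have : ((x : ℕ) : ℝ) < (y : ℕ) := by exact_mod_cast hxy
    exact div_lt_div_of_pos_right this hN0
  · simp [hs]
  · simp only [hs, Fin.val_last, Nat.cast_add, Nat.cast_one]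
    exact div_self hN0.ne'
  · exact ((hcb _ (i n).2).mono (hsub n)).sub ((hca _ (i n).2).mono (hsub n))
  · refine ⟨finrank ℂ (spectralProj (γ (s n.castSucc)) (a (i n)) (b (i n))).range,
      fun t ht => ⟨finiteDimensional_range_spectralProj (hsa t (hsub01 n ht)) hP
        (hK t (hsub01 n ht)) (hab n) (ma n) (mb n), ?_⟩⟩
    have h0 : s n.castSucc ∈ Set.Icc (s n.castSucc) (s n.succ) :=
      Set.left_mem_Icc.mpr (by rw [hstep]; linarith [one_div_pos.mpr hN0])
    -- The rank is the relative dimension of `E_b` and `E_a`. Both vary norm continuously on the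
    -- piece, so changing the parameter does not alter it.
    have e1 := relIndex_specSubspace_eq_zero hsa hP hK (ma n) (hsub01 n)
      ((hca _ (i n).2).mono (hsub n)) h0 ht
    have e2 := relIndex_specSubspace_eq_zero hsa hP hK (mb n) (hsub01 n)
      ((hcb _ (i n).2).mono (hsub n)) ht h0
    have m0 := hsub01 n h0
    have mt := hsub01 n ht
    have e3 := relIndex_specSubspace_triangle hsa hP hK mt m0 mt (mb n) (mb n) (ma n)
    have e4 := relIndex_specSubspace_triangle hsa hP hK m0 m0 mt (mb n) (ma n) (ma n)
    rw [relIndex_specSubspace _ (hab n)] at e3 e4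
    rw [← Nat.cast_inj (R := ℤ)]
    linarith

/-- For every choice of admissible data, the spectral flow is the relative dimension of the
non-positive spectral subspaces at the end points. -/
theorem partitionFlow_eq_relIndex {N : ℕ} {s : Fin (N + 1) → ℝ} {a b : Fin N → ℝ}
    (h : IsAdmissible γ s a b) :
    partitionFlow γ s a = relIndex (specSubspace (γ 0) 0) (specSubspace (γ 1) 0) := by
  have hs01 : ∀ i, s i ∈ Set.Icc (0 : ℝ) 1 := fun i =>
    ⟨h.first ▸ h.strictMono.monotone (Fin.zero_le i), h.last ▸ h.strictMono.monotone (Fin.le_last i)⟩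
  have m0 : (0 : ℝ) ∈ Set.Ioo (-1 : ℝ) 1 := by norm_num
  have mz : (0 : ℝ) ∈ Set.Icc (0 : ℝ) 1 := by norm_num
  -- Relative dimension to the starting point serves as a potential whose decrements are the
  -- summands.
  set f : Fin (N + 1) → ℤ := fun i =>
    relIndex (specSubspace (γ (s i)) 0) (specSubspace (γ 0) 0) with hf
  have hpiece : ∀ n : Fin N,
      ((finrank ℂ (spectralProj (γ (s n.castSucc)) (a n) 0).range : ℤ) -
        (finrank ℂ (spectralProj (γ (s n.succ)) (a n) 0).range : ℤ)) =
      f n.castSucc - f n.succ := by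
    intro n
    have hsub01 : Set.Icc (s n.castSucc) (s n.succ) ⊆ Set.Icc 0 1 :=
      Set.Icc_subset_Icc (hs01 _).1 (hs01 _).2
    have hle : s n.castSucc ≤ s n.succ := h.strictMono.monotone (Fin.castSucc_lt_succ).le
    have ha := h.mem_a n
    have ma : a n ∈ Set.Ioo (-1 : ℝ) 1 := ⟨ha.1, ha.2.trans one_pos⟩
    have hc := continuousOn_spectralFamily_of_spectralProj (hγ.mono hsub01)
      (fun t ht => hsa t (hsub01 ht)) (ha.2.trans (h.mem_b n).1) (h.continuousOn n)
    have e0 := relIndex_specSubspace_eq_zero hsa hP hK ma hsub01 hc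
      (Set.left_mem_Icc.mpr hle) (Set.right_mem_Icc.mpr hle)
    have e1 := relIndex_specSubspace_triangle hsa hP hK (hs01 n.castSucc) (hs01 n.succ) mz m0 m0 m0
    have e2 := relIndex_specSubspace_triangle hsa hP hK (hs01 n.castSucc) (hs01 n.succ)
      (hs01 n.succ) m0 m0 ma
    have e3 := relIndex_specSubspace_triangle hsa hP hK (hs01 n.castSucc) (hs01 n.castSucc)
      (hs01 n.succ) m0 ma ma
    rw [relIndex_specSubspace _ ha.2.le] at e2 e3
    simp only [hf]
    linarith
  have htel : ∑ n : Fin N, (f n.castSucc - f n.succ) = f 0 - f (Fin.last N) := by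
    have h1 := Fin.sum_univ_castSucc f
    have h2 := Fin.sum_univ_succ f
    rw [Finset.sum_sub_distrib]
    linarith
  rw [partitionFlow, Finset.sum_congr rfl fun n _ => hpiece n, htel]
  simp only [hf, h.first, h.last]
  rw [relIndex_swap (specSubspace (γ 0) 0) (specSubspace (γ 1) 0)]
  simp [relIndex]

theorem hasSpectralFlow_relIndex :
    HasSpectralFlow γ (relIndex (specSubspace (γ 0) 0) (specSubspace (γ 1) 0)) where
  continuousOn := hγ
  mem t ht := ⟨hsa t ht, isFredholm_of_isCompactOperator_sub_symmetry hP (hK t ht)⟩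
  exists_admissible := exists_isAdmissible hγ hsa hP hK
  value _ _ _ _ h := partitionFlow_eq_relIndex hγ hsa hP hK h

end

end Path

/-! ### Spectral subspaces of a symmetry -/

section Symmetry

variable {H : Type*} [NormedAddCommGroup H] [InnerProductSpace ℂ H] [CompleteSpace H]
  {A : H →L[ℂ] H}

/-- The spectrum lies in `{-1, 1}`, where `x₊` agrees with `(x + 1) / 2`. -/
theorem mem_specSubspace_zero_iff (hA : IsSelfAdjoint A) (h : A * A = 1) {v : H} :
    v ∈ specSubspace A 0 ↔ A v = -v := by
  have hs : (spectrum ℝ A).EqOn (fun x : ℝ => x * x) (fun _ => 1) := by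
    rw [← cfc_eq_cfc_iff_eqOn (a := A) (R := ℝ) hA (by fun_prop) (by fun_prop)]
    rw [cfc_mul (fun x : ℝ => x) (fun x => x) A, cfc_id' ℝ A, h, cfc_const_one ℝ A]
  have hc : cfc (fun x : ℝ => max (x - 0) 0) A = (1 / 2 : ℝ) • (A + 1) := by
    have h1 : cfc (fun x : ℝ => max (x - 0) 0) A = cfc (fun x : ℝ => (1 / 2 : ℝ) • (x + 1)) A := by
      refine cfc_congr fun x hx => ?_
      have hx' : x * x = 1 := hs hx
      rcases mul_self_eq_one_iff.mp hx' with rfl | rfl <;> norm_num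
    rw [h1, cfc_smul (1 / 2 : ℝ) (fun x => x + 1) A (by fun_prop),
      cfc_add_const 1 (fun x => x) A (by fun_prop), cfc_id' ℝ A, map_one]
  rw [specSubspace, hc, LinearMap.mem_ker]
  have : (((1 / 2 : ℝ) • (A + 1) : H →L[ℂ] H) : H →ₗ[ℂ] H) v = (1 / 2 : ℝ) • (A v + v) := rfl
  rw [this, smul_eq_zero, eq_neg_iff_add_eq_zero]
  norm_num

theorem mem_specSubspace_zero_orthogonal_iff (hA : IsSelfAdjoint A) (h : A * A = 1) {v : H} :
    v ∈ (specSubspace A 0)ᗮ ↔ A v = v := by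
  have hAA : ∀ w, A (A w) = w := fun w => congr($h w)
  have hsym : ∀ x y, ⟪A x, y⟫_ℂ = ⟪x, A y⟫_ℂ := hA.isSymmetric
  constructor
  · intro hv
    have h1 : ∀ w, ⟪w, v - A v⟫_ℂ = 0 := by
      intro w
      have hw : w - A w ∈ specSubspace A 0 := by
        rw [mem_specSubspace_zero_iff hA h, map_sub, hAA]
        abel
      have := hv _ hw
      rw [inner_sub_left, hsym] at this
      rw [inner_sub_right, this]
    exact (sub_eq_zero.mp (inner_self_eq_zero.mp (h1 _))).symm
  · intro hv w hw
    rw [mem_specSubspace_zero_iff hA h] at hw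
    have h1 := hsym w v
    rw [hv, hw, inner_neg_left] at h1
    have h2 : (2 : ℂ) * ⟪w, v⟫_ℂ = 0 := by linear_combination -h1
    simpa using h2

end Symmetry

/-! ### Uniqueness of the flow and the straight line path -/

section Flow

variable {H : Type*} [NormedAddCommGroup H] [InnerProductSpace ℂ H] [CompleteSpace H]

theorem HasSpectralFlow.unique {γ : ℝ → H →L[ℂ] H} {m n : ℤ} (hm : HasSpectralFlow γ m)
    (hn : HasSpectralFlow γ n) : m = n := by
  obtain ⟨N, s, a, b, h⟩ := hm.exists_admissible
  rw [← hm.value N s a b h, hn.value N s a b h]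

theorem HasSpectralFlow.spectralFlow_eq {γ : ℝ → H →L[ℂ] H} {m : ℤ} (h : HasSpectralFlow γ m) :
    spectralFlow γ = m := by
  have he : ∃ m, HasSpectralFlow γ m := ⟨m, h⟩
  rw [spectralFlow, dif_pos he]
  exact he.choose_spec.unique h

theorem HasPairSpectralFlow.pairSpectralFlow_eq {F U : H →L[ℂ] H} {m : ℤ}
    (h : HasPairSpectralFlow F U m) : pairSpectralFlow F U = m := by
  have he : ∃ m, HasPairSpectralFlow F U m := ⟨m, h⟩
  rw [pairSpectralFlow, dif_pos he]
  obtain ⟨γ, hγ⟩ := h.nonempty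
  exact (he.choose_spec.value γ hγ).unique (h.value γ hγ)

theorem IsPerturbationPath.hasSpectralFlow {F U P : H →L[ℂ] H} (hP : P * P = P)
    (hF : F = 2 * P - 1) {γ : ℝ → H →L[ℂ] H} (hγ : IsPerturbationPath F U γ) :
    HasSpectralFlow γ (relIndex (specSubspace F 0) (specSubspace (adjoint U * F * U) 0)) := by
  have := hasSpectralFlow_relIndex hγ.continuousOn hγ.isSelfAdjoint hP
    (fun t ht => hF ▸ hγ.isCompact t ht)
  rwa [hγ.zero, hγ.one] at this

/-- Unitarity turns `U*[F, U]` into `U*FU - F`, which is self-adjoint and joins the two end points.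
-/
theorem isPerturbationPath_linePath {F U : H →L[ℂ] H} (hF : IsSelfAdjoint F)
    (hU : adjoint U * U = 1) (hc : IsCompactOperator (F * U - U * F : H →L[ℂ] H)) :
    IsPerturbationPath F U (linePath F U) := by
  have e : adjoint U * (F * U - U * F) = adjoint U * F * U - F := by
    rw [mul_sub, ← mul_assoc, ← mul_assoc, hU, one_mul]
  refine ⟨?_, fun t _ => ?_, by simp [linePath], fun t _ => ?_, by simp [linePath, e]⟩
  · unfold linePath
    fun_prop
  · have h1 : IsSelfAdjoint (adjoint U * F * U - F) :=
      IsSelfAdjoint.sub (by simpa [star_eq_adjoint] using hF.conjugate' U) hF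
    rw [linePath, e]
    refine hF.add (IsSelfAdjoint.smul ?_ h1)
    simp [IsSelfAdjoint]
  · have h1 := (hc.clm_comp (adjoint U)).smul (t : ℂ)
    exact isCompactOperator_of_forall_eq h1 fun x => by simp [linePath]

end Flow

/-! ### The symmetry of a unitary dilation -/

section Dilation

variable {K H : Type*} [NormedAddCommGroup K] [InnerProductSpace ℂ K] [CompleteSpace K]
  [NormedAddCommGroup H] [InnerProductSpace ℂ H] [CompleteSpace H] (J : K →ₗᵢ[ℂ] H)

/-- The orthogonal projection `J J*` onto the range of the isometry `J`. -/
def rangeProj : H →L[ℂ] H :=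
  J.toContinuousLinearMap ∘L adjoint J.toContinuousLinearMap

theorem adjoint_apply_apply (x : K) :
    adjoint J.toContinuousLinearMap (J x) = x :=
  congr($(J.adjoint_comp_self) x)

theorem rangeProj_apply (x : H) : rangeProj J x = J (adjoint J.toContinuousLinearMap x) := rfl

theorem rangeProj_mul_self : rangeProj J * rangeProj J = rangeProj J := by
  ext x
  simp [rangeProj_apply, adjoint_apply_apply]

theorem isSelfAdjoint_rangeProj : IsSelfAdjoint (rangeProj J) := by
  rw [isSelfAdjoint_iff', rangeProj, adjoint_comp, adjoint_adjoint]

theorem dilationSymmetry_eq : dilationSymmetry J = 2 * rangeProj J - 1 := by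
  rw [dilationSymmetry, two_smul, two_mul, rangeProj]

theorem dilationSymmetry_apply (x : H) : dilationSymmetry J x = (2 : ℂ) • rangeProj J x - x := rfl

theorem isSelfAdjoint_dilationSymmetry : IsSelfAdjoint (dilationSymmetry J) := by
  rw [dilationSymmetry_eq, two_mul]
  exact ((isSelfAdjoint_rangeProj J).add (isSelfAdjoint_rangeProj J)).sub (.one _)

theorem dilationSymmetry_mul_self : dilationSymmetry J * dilationSymmetry J = 1 := by
  rw [dilationSymmetry_eq]
  have : (2 * rangeProj J - 1) * (2 * rangeProj J - 1) =
      4 * (rangeProj J * rangeProj J) - 4 * rangeProj J + 1 := by noncomm_ring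
  rw [this, rangeProj_mul_self]; abel

theorem dilationSymmetry_apply_eq_neg_iff {v : H} :
    dilationSymmetry J v = -v ↔ adjoint J.toContinuousLinearMap v = 0 := by
  rw [dilationSymmetry_apply, rangeProj_apply, sub_eq_neg_self, smul_eq_zero,
    or_iff_right two_ne_zero]
  exact map_eq_zero_iff J J.injective

theorem dilationSymmetry_apply_eq_self_iff {v : H} :
    dilationSymmetry J v = v ↔ ∃ x, J x = v := by
  rw [dilationSymmetry_apply, sub_eq_iff_eq_add, ← two_smul ℂ v]
  constructor
  · intro h
    exact ⟨_, smul_right_injective H (two_ne_zero (α := ℂ)) h⟩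
  · rintro ⟨x, rfl⟩
    rw [rangeProj_apply, adjoint_apply_apply]

/-- From `F² = 1`, `(F - z)(F + z) = 1 - z²` gives invertibility off `±1`. At `1` and `-1` the
kernel contains the infinite-dimensional range of `J` and its complement, respectively. -/
theorem essentialSpectrum_dilationSymmetry (hK : ¬ FiniteDimensional ℂ K)
    (hJ : ¬ FiniteDimensional ℂ (J.toLinearMap.range)ᗮ) :
    essentialSpectrum (dilationSymmetry J) = {-1, 1} := by
  set F := dilationSymmetry J with hF
  ext z
  constructor
  · intro hz
    by_contra hne
    simp only [Set.mem_insert_iff, Set.mem_singleton_iff, not_or] at hne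
    have hz2 : 1 - z * z ≠ 0 := by
      intro h
      rcases mul_self_eq_one_iff.mp (sub_eq_zero.mp h).symm with h | h
      exacts [hne.2 h, hne.1 h]
    refine hz ?_
    have hFF : ∀ w, F (F w) = w := fun w => congr($(dilationSymmetry_mul_self J) w)
    have hzero : IsCompactOperator (0 : H →L[ℂ] H) := isCompactOperator_zero
    have hinv : (1 - z * z)⁻¹ * (1 - z * z) = 1 := inv_mul_cancel₀ hz2
    refine isFredholm_of_isCompactOperator_comp_sub_one
      (B := (1 - z * z)⁻¹ • (F + z • (1 : H →L[ℂ] H))) ?_ ?_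
    · refine isCompactOperator_of_forall_eq hzero fun x => ?_
      have : F ((1 - z * z)⁻¹ • (F x + z • x)) - z • ((1 - z * z)⁻¹ • (F x + z • x)) - x = 0 := by
        rw [map_smul, map_add, map_smul, hFF, smul_comm z, ← smul_sub]
        have : x + z • F x - z • (F x + z • x) = (1 - z * z) • x := by module
        rw [this, smul_smul, hinv, one_smul, sub_self]
      simpa using this
    · refine isCompactOperator_of_forall_eq hzero fun x => ?_
      have : (1 - z * z)⁻¹ • (F (F x - z • x) + z • (F x - z • x)) - x = 0 := by
        rw [map_sub, map_smul, hFF]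
        have : x - z • F x + z • (F x - z • x) = (1 - z * z) • x := by module
        rw [this, smul_smul, hinv, one_smul, sub_self]
      simpa using this
  · rintro (rfl | rfl) hz
    · have := hz.finite_ker
      refine hJ (Submodule.finiteDimensional_of_le
        (S₂ := (F - (-1 : ℂ) • (1 : H →L[ℂ] H)).ker) fun v hv => ?_)
      have h1 : adjoint J.toContinuousLinearMap v = 0 := by
        have h2 : J.toContinuousLinearMap.range = J.toLinearMap.range := rfl
        rw [← h2, ContinuousLinearMap.orthogonal_range] at hv
        exact hv
      have h3 := (dilationSymmetry_apply_eq_neg_iff J).mpr h1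
      rw [LinearMap.mem_ker]
      simp [hF, h3]
    · have := hz.finite_ker
      let f : K →ₗ[ℂ] (F - (1 : ℂ) • (1 : H →L[ℂ] H)).ker :=
        J.toLinearMap.codRestrict _ fun x => by
          have h3 := (dilationSymmetry_apply_eq_self_iff J).mpr ⟨x, rfl⟩
          rw [LinearMap.mem_ker]
          simp [hF, h3]
      refine hK (Module.Finite.of_injective f fun x y hxy => J.injective ?_)
      exact congrArg Subtype.val hxy

theorem dilationSymmetry_mem_selfAdjointFredholmHat (hK : ¬ FiniteDimensional ℂ K)
    (hJ : ¬ FiniteDimensional ℂ (J.toLinearMap.range)ᗮ) :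
    dilationSymmetry J ∈ selfAdjointFredholmHat H := by
  have hess := essentialSpectrum_dilationSymmetry J hK hJ
  have hsa := isSelfAdjoint_dilationSymmetry J
  have hn : Nontrivial H := by
    by_contra h
    rw [not_nontrivial_iff_subsingleton] at h
    exact hJ inferInstance
  refine ⟨⟨⟨hsa, ?_⟩, ⟨1, one_pos, by simp [hess]⟩, ⟨-1, by norm_num, by simp [hess]⟩⟩, ?_, hess⟩
  · by_contra h
    have h0 : (0 : ℂ) ∈ essentialSpectrum (dilationSymmetry J) := by
      simpa [essentialSpectrum] using h
    rw [hess] at h0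
    simp at h0
  · refine CStarRing.norm_of_mem_unitary (Unitary.mem_iff.mpr ?_)
    rw [hsa.star_eq]
    exact ⟨dilationSymmetry_mul_self J, dilationSymmetry_mul_self J⟩

variable {J} {T : K →L[ℂ] K} {U : H →L[ℂ] H}

theorem IsUnitaryDilation.adjoint_apply_apply (hU : IsUnitaryDilation J T U) (x : H) :
    adjoint U (U x) = x :=
  congr($((Unitary.mem_iff.mp hU.unitary).1) x)

theorem IsUnitaryDilation.apply_adjoint_apply (hU : IsUnitaryDilation J T U) (x : H) :
    U (adjoint U x) = x :=
  congr($((Unitary.mem_iff.mp hU.unitary).2) x)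

theorem IsUnitaryDilation.apply_eq (hU : IsUnitaryDilation J T U) (x : K) :
    T x = adjoint J.toContinuousLinearMap (U (J x)) :=
  congr($(hU.compression) x)

/-- The adjoint dilates the adjoint. -/
theorem IsUnitaryDilation.adjoint (hU : IsUnitaryDilation J T U) :
    IsUnitaryDilation J (adjoint T) (adjoint U) where
  unitary := Unitary.star_mem hU.unitary
  compression := by
    rw [hU.compression, adjoint_comp, adjoint_comp, adjoint_adjoint]
    rfl

/-- The off-diagonal part of a unitary dilation is compact if `T*T - 1` is. -/
theorem IsUnitaryDilation.isCompactOperator_offDiagonal (hU : IsUnitaryDilation J T U)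
    (hT : IsCompactOperator (ContinuousLinearMap.adjoint T * T - 1 : K →L[ℂ] K)) :
    IsCompactOperator ((1 - rangeProj J) ∘L U ∘L J.toContinuousLinearMap : K →L[ℂ] H) := by
  -- For `B = (1 - JJ*)UJ`, unitarity of `U` gives `B*B = 1 - T*T`.
  refine isCompactOperator_of_adjoint_comp_self (isCompactOperator_of_forall_eq hT.neg fun x => ?_)
  have h1 : ContinuousLinearMap.adjoint (1 - rangeProj J) = 1 - rangeProj J :=
    ((IsSelfAdjoint.one _).sub (isSelfAdjoint_rangeProj J)).adjoint_eq
  rw [adjoint_comp, adjoint_comp, h1]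
  simp [rangeProj_apply, hU.apply_eq, hU.adjoint.apply_eq, hU.adjoint_apply_apply,
    SpectralFlow.adjoint_apply_apply]

/-- With `P = JJ*`, `[F, U] = 2(PU(1 - P) - (1 - P)UP)`. The second corner is compact by `T*T - 1`,
the first by `TT* - 1` through the adjoint dilation. -/
theorem IsUnitaryDilation.isCompactOperator_commutator (hU : IsUnitaryDilation J T U)
    (hT : IsEssentiallyUnitary T) :
    IsCompactOperator (dilationSymmetry J * U - U * dilationSymmetry J : H →L[ℂ] H) := by
  have hB := hU.isCompactOperator_offDiagonal hT.left
  have hC := hU.adjoint.isCompactOperator_offDiagonal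
    (by rw [adjoint_adjoint]; exact hT.right)
  set C := (1 - rangeProj J) ∘L ContinuousLinearMap.adjoint U ∘L J.toContinuousLinearMap with hCdef
  have hC' : IsCompactOperator (ContinuousLinearMap.adjoint C) :=
    isCompactOperator_of_adjoint_comp_self (by
      rw [adjoint_adjoint]
      exact hC.comp_clm _)
  have h1 : ContinuousLinearMap.adjoint (1 - rangeProj J) = 1 - rangeProj J :=
    ((IsSelfAdjoint.one _).sub (isSelfAdjoint_rangeProj J)).adjoint_eq
  rw [hCdef, adjoint_comp, adjoint_comp, adjoint_adjoint, h1] at hC'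
  have h3 := ((hC'.clm_comp J.toContinuousLinearMap).sub
    (hB.comp_clm (ContinuousLinearMap.adjoint J.toContinuousLinearMap))).smul (2 : ℂ)
  refine isCompactOperator_of_forall_eq h3 fun x => ?_
  simp [dilationSymmetry_apply, rangeProj_apply]
  module

/-- The negative eigenspace of `F` is `ker J*` and its complement is `ran J`; for `U*FU` both are
pulled back by `U`. A vector `Jx` with `J*UJx = 0` means `x ∈ ker T`, and the other intersection is
`U*J(ker T*)`. -/
theorem IsUnitaryDilation.relIndex_eq (hU : IsUnitaryDilation J T U) :
    relIndex (specSubspace (dilationSymmetry J) 0)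
      (specSubspace (ContinuousLinearMap.adjoint U * dilationSymmetry J * U) 0) =
      -noetherIndex T := by
  set F := dilationSymmetry J with hF
  have hsa : IsSelfAdjoint F := isSelfAdjoint_dilationSymmetry J
  have hFF : F * F = 1 := dilationSymmetry_mul_self J
  set G := ContinuousLinearMap.adjoint U * F * U with hG
  have hGsa : IsSelfAdjoint G := hsa.conjugate' U
  have hGG : G * G = 1 := by
    ext x
    have := fun w => congr($hFF w)
    simp only [mul_apply_eq_comp, one_apply_eq_self] at this
    simp [hG, hU.apply_adjoint_apply, hU.adjoint_apply_apply, this]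
  have hinjU : Function.Injective U := Function.LeftInverse.injective hU.adjoint_apply_apply
  have hinjU' : Function.Injective (ContinuousLinearMap.adjoint U) :=
    Function.LeftInverse.injective hU.apply_adjoint_apply
  have hGv : ∀ v w, G v = w ↔ F (U v) = U w := by
    intro v w
    rw [← hinjU.eq_iff]
    simp [hG, hU.apply_adjoint_apply]
  have e1 : T.ker.map J.toLinearMap = specSubspace G 0 ⊓ (specSubspace F 0)ᗮ := by
    ext v
    rw [Submodule.mem_map, Submodule.mem_inf, mem_specSubspace_zero_iff hGsa hGG,
      mem_specSubspace_zero_orthogonal_iff hsa hFF, hGv, map_neg, hF,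
      dilationSymmetry_apply_eq_neg_iff, dilationSymmetry_apply_eq_self_iff]
    constructor
    · rintro ⟨x, hx, rfl⟩
      exact ⟨(hU.apply_eq x).symm.trans hx, x, rfl⟩
    · rintro ⟨hv, x, rfl⟩
      exact ⟨x, (hU.apply_eq x).trans hv, rfl⟩
  have e2 : (ContinuousLinearMap.adjoint T).ker.map
      ((ContinuousLinearMap.adjoint U).toLinearMap ∘ₗ J.toLinearMap) =
      specSubspace F 0 ⊓ (specSubspace G 0)ᗮ := by
    ext v
    rw [Submodule.mem_map, Submodule.mem_inf, mem_specSubspace_zero_iff hsa hFF,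
      mem_specSubspace_zero_orthogonal_iff hGsa hGG, hGv, hF,
      dilationSymmetry_apply_eq_neg_iff, dilationSymmetry_apply_eq_self_iff]
    constructor
    · rintro ⟨x, hx, rfl⟩
      exact ⟨(hU.adjoint.apply_eq x).symm.trans hx, x, (hU.apply_adjoint_apply _).symm⟩
    · rintro ⟨hv, x, hx⟩
      have hxv : ContinuousLinearMap.adjoint U (J x) = v := by rw [hx, hU.adjoint_apply_apply]
      exact ⟨x, (hU.adjoint.apply_eq x).trans (hxv ▸ hv), hxv⟩
  rw [relIndex, ← e1, ← e2, noetherIndex,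
    ← (Submodule.equivMapOfInjective J.toLinearMap J.injective _).finrank_eq,
    ← (Submodule.equivMapOfInjective ((ContinuousLinearMap.adjoint U).toLinearMap ∘ₗ
      J.toLinearMap) (hinjU'.comp J.injective) _).finrank_eq]
  ring

end Dilation

end

end SpectralFlow

theorem mainTheorem2
    {K H : Type*} [NormedAddCommGroup K] [InnerProductSpace ℂ K] [CompleteSpace K]
    [NormedAddCommGroup H] [InnerProductSpace ℂ H] [CompleteSpace H]
    (T : K →L[ℂ] K) (hT : ‖T‖ ≤ 1) (hTu : SpectralFlow.IsEssentiallyUnitary T)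
    (J : K →ₗᵢ[ℂ] H) (hJ : ¬ FiniteDimensional ℂ (J.toLinearMap.range)ᗮ)
    (U : H →L[ℂ] H) (hU : SpectralFlow.IsUnitaryDilation J T U)
    (F : H →L[ℂ] H) (hF : F = SpectralFlow.dilationSymmetry J) :
    T.IsFredholm ∧
    (¬ FiniteDimensional ℂ K → F ∈ SpectralFlow.selfAdjointFredholmHat H) ∧
    IsCompactOperator (F * U - U * F : H →L[ℂ] H) ∧
    SpectralFlow.HasPairSpectralFlow F U (SpectralFlow.pairSpectralFlow F U) ∧
    SpectralFlow.IsPerturbationPath F U (SpectralFlow.linePath F U) ∧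
    SpectralFlow.noetherIndex T = -SpectralFlow.pairSpectralFlow F U ∧
    -SpectralFlow.pairSpectralFlow F U =
      -SpectralFlow.spectralFlow (SpectralFlow.linePath F U) := by
  subst hF
  have hsa := SpectralFlow.isSelfAdjoint_dilationSymmetry J
  have hc := hU.isCompactOperator_commutator hTu
  have hline := SpectralFlow.isPerturbationPath_linePath hsa (Unitary.mem_iff.mp hU.unitary).1 hc
  have hflow := fun (γ : ℝ → H →L[ℂ] H)
      (hγ : SpectralFlow.IsPerturbationPath (SpectralFlow.dilationSymmetry J) U γ) =>
    hU.relIndex_eq ▸ hγ.hasSpectralFlow (SpectralFlow.rangeProj_mul_self J)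
      (SpectralFlow.dilationSymmetry_eq J)
  have hpair : SpectralFlow.HasPairSpectralFlow (SpectralFlow.dilationSymmetry J) U
      (-SpectralFlow.noetherIndex T) := ⟨⟨_, hline⟩, hflow⟩
  rw [hpair.pairSpectralFlow_eq, (hflow _ hline).spectralFlow_eq, neg_neg]
  exact ⟨SpectralFlow.isFredholm_of_isCompactOperator_comp_sub_one hTu.left hTu.right,
    fun hK => SpectralFlow.dilationSymmetry_mem_selfAdjointFredholmHat J hK hJ, hc, hpair, hline,
    rfl, rfl⟩
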